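/- Let $S=\{1,\dots,N\}$ and $\mathcal K=\{1,\dots,K\}$, let $A_i\in\mathbb R^{n\times n}$ and $B_i\in\mathbb R^{n\times m}$ for $i\in S$, let $C_1,\dots,C_K$ be Borel sets that partition $\mathbb R^n$, and for each $\kappa\in\mathcal K$ let $(\lambda^\kappa_{ij})_{i,j\in S}$ be a transition rate matrix, that is, $\lambda^\kappa_{ij}\ge 0$ for $i\ne j$ and $\lambda^\kappa_{ii}=-\sum_{j\ne i}\lambda^\kappa_{ij}$. On a probability space $(\Omega,\mathcal F,\Pr)$ consider the controlled state-dependent jump linear system $$\dot x(t)=A_{\theta(t)}x(t)+B_{\theta(t)}u(t),\qquad x(t)\in\mathbb R^n,\ u(t)\in\mathbb R^m,$$ where the mode $\theta(t)\in S$ is a jump process with right-continuous, piecewise constant paths that jumps from $i$ to $j\neq i$ at rate $\lambda^{\kappa}_{ij}$ while $x(t)\in C_\kappa$. That is, with $\sigma_t$ denoting the index $\kappa$ with $x(t)\in C_\kappa$, for all $t,h\ge 0$ and $j\in S$, $$\Pr\bigl(\theta(t+h)=j\mid x(t),\theta(t)\bigr)=1_{\{\theta(t)=j\}}+\mathbb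 E\Bigl[\int_t^{t+h}\lambda^{\sigma_s}_{\theta(s)j}\,ds\Bigm| x(t),\theta(t)\Bigr],$$ which is the time-integrated form of $\Pr(\theta(t+h)=j\mid x(t),\theta(t)=i)=\lambda^{\sigma_t}_{ij}h+o(h)$ for $j\ne i$. Suppose there are matrices $X_i\succ 0$ in $\mathbb R^{n\times n}$ (symmetric positive definite) and $Y_i\in\mathbb R^{m\times n}$, $i\in S$, such that for every $\kappa\in\mathcal K$ and every $i\in S$ $$\begin{bmatrix}J_{\kappa i}&\mathcal M_{\kappa i}\\ \mathcal M_{\kappa i}^T&-\mathcal X_i\end{bmatrix}\prec 0,$$ where $$J_{\kappa i}=X_iA_i^T+Y_i^TB_i^T+A_iX_i+B_iY_i+\lambda^\kappa_{ii}X_i,$$ $$\mathcal M_{\kappa i}=\bigl[\sqrt{\lambda^\kappa_{i1}}X_i\ \cdots\ \sqrt{\lambda^\kappa_{i,i-1}}X_i\ \ \sqrt{\lambda^\kappa_{i,i+1}}X_i\ \cdots\ \sqrt{\lambda^\kappa_{iN}}X_i\bigr],$$ $$\mathcal X_i=\mathrm{diag}\{X_1,\dots,X_{i-1},X_{i+1},\dots,X_N\}.$$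 Then the mode-dependent state feedback $u(t)=K_{\theta(t)}x(t)$ with gains $K_i=Y_iX_i^{-1}$ stochastically stabilizes the system: every solution $(x,\theta)$ of the closed loop $\dot x(t)=(A_{\theta(t)}+B_{\theta(t)}K_{\theta(t)})x(t)$ with the above transition rates satisfies $$\mathbb E\Bigl[\int_0^\infty\|x(t)\|^2\,dt\Bigr]<\infty$$ for every initial state $x(0)=x_0\in\mathbb R^n$ and every initial mode $\theta(0)=i_0\in S$. -/

import Mathlib

open MeasureTheory Set Filter Topology
open scoped Matrix

namespace SDJLS

/-- The transition rate from mode `i` to mode `j` at the state `v`: it equals `lam κ i j` when `v`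
lies in the region `C κ` (the regions are assumed to partition the state space). -/
noncomputable def stateRate {n N K : ℕ} (lam : Fin K → Matrix (Fin N) (Fin N) ℝ)
    (C : Fin K → Set (EuclideanSpace ℝ (Fin n))) (v : EuclideanSpace ℝ (Fin n))
    (i j : Fin N) : ℝ :=
  ∑ κ, (C κ).indicator (fun _ => lam κ i j) v

/-- `lam` is a family of transition rate matrices, one for each region: the off-diagonal entries
are nonnegative and every row sums to zero. -/
structure IsRateFamily {N K : ℕ} (lam : Fin K → Matrix (Fin N) (Fin N) ℝ) : Prop where
  nonneg : ∀ κ i j, i ≠ j → 0 ≤ lam κ i j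
  diag : ∀ κ i, lam κ i i = -∑ j ∈ Finset.univ.erase i, lam κ i j

/-- The sets `C κ` are Borel sets which partition the state space (some may be empty). -/
structure IsRegionPartition {n K : ℕ} (C : Fin K → Set (EuclideanSpace ℝ (Fin n))) : Prop where
  measurableSet : ∀ κ, MeasurableSet (C κ)
  disjoint : ∀ κ κ', κ ≠ κ' → Disjoint (C κ) (C κ')
  iUnion_eq : ⋃ κ, C κ = univ

/-- The pair `(x, θ)` of processes with time parameter `t ≥ 0` is a solution of the state-dependent
jump linear system `ẋ(t) = A_{θ(t)} x(t)` with initial state `x₀` and initial mode `i₀`, whose mode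
`θ` jumps from `i` to `j ≠ i` at the rate `lam κ i j` while `x` is in the region `C κ`. -/
structure IsSolution {n N K : ℕ} {Ω : Type*} [MeasurableSpace Ω] (μ : Measure Ω)
    (A : Fin N → Matrix (Fin n) (Fin n) ℝ) (lam : Fin K → Matrix (Fin N) (Fin N) ℝ)
    (C : Fin K → Set (EuclideanSpace ℝ (Fin n)))
    (x₀ : EuclideanSpace ℝ (Fin n)) (i₀ : Fin N)
    (x : ℝ → Ω → EuclideanSpace ℝ (Fin n)) (θ : ℝ → Ω → Fin N) : Prop where
  measurable_state : ∀ t, 0 ≤ t → Measurable (x t)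
  measurable_mode : ∀ t, 0 ≤ t → Measurable (θ t)
  init_state : ∀ᵐ ω ∂μ, x 0 ω = x₀
  init_mode : ∀ᵐ ω ∂μ, θ 0 ω = i₀
  /-- The paths of the mode are right-continuous and have left limits in the discrete space of
  modes, so they are piecewise constant with finitely many jumps in bounded time. -/
  mode_right : ∀ᵐ ω ∂μ, ∀ t, 0 ≤ t → ∀ᶠ s in 𝓝[>] t, θ s ω = θ t ω
  mode_left : ∀ᵐ ω ∂μ, ∀ t, 0 < t → ∃ i, ∀ᶠ s in 𝓝[<] t, θ s ω = i
  state_continuous : ∀ᵐ ω ∂μ, ContinuousOn (fun t => x t ω) (Ici 0)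
  /-- The differential equation. At a jump time of the mode only the right derivative exists; at
  all other times a continuous path with this property is differentiable. -/
  state_deriv : ∀ᵐ ω ∂μ, ∀ t, 0 ≤ t →
    HasDerivWithinAt (fun s => x s ω) (Matrix.toEuclideanLin (A (θ t ω)) (x t ω)) (Ici t) t
  /-- The transition rates of the mode, with respect to the present state and mode:
  `Pr(θ(t+h) = j | x(t), θ(t)) = 1_{θ(t) = j} + E[∫_t^{t+h} λ_{θ(s) j}(x(s)) ds | x(t), θ(t)]`.
  This is `Pr(θ(t+h) = j | x(t), θ(t) = i) = λ_{ij}(x(t)) h + o(h)` for `j ≠ i`, integrated over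
  time. In this form it makes sense also at those times at which `x` passes from one region to
  another and the rate jumps. -/
  mode_rate : ∀ t h, 0 ≤ t → 0 ≤ h → ∀ j : Fin N,
    μ[fun ω => if θ (t + h) ω = j then (1 : ℝ) else 0 |
        MeasurableSpace.comap (fun ω => (x t ω, θ t ω)) inferInstance]
      =ᵐ[μ]
    μ[fun ω => (if θ t ω = j then (1 : ℝ) else 0)
          + ∫ s in t..(t + h), stateRate lam C (x s ω) (θ s ω) j |
        MeasurableSpace.comap (fun ω => (x t ω, θ t ω)) inferInstance]

/-- Stochastic stability of `ẋ(t) = A_{θ(t)} x(t)` on the probability space `(Ω, μ)`: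
`E[∫_0^∞ ‖x(t)‖² dt] < ∞` for every initial state and every initial mode. -/
def StochasticallyStable {n N K : ℕ} {Ω : Type*} [MeasurableSpace Ω] (μ : Measure Ω)
    (A : Fin N → Matrix (Fin n) (Fin n) ℝ) (lam : Fin K → Matrix (Fin N) (Fin N) ℝ)
    (C : Fin K → Set (EuclideanSpace ℝ (Fin n))) : Prop :=
  ∀ (x₀ : EuclideanSpace ℝ (Fin n)) (i₀ : Fin N)
    (x : ℝ → Ω → EuclideanSpace ℝ (Fin n)) (θ : ℝ → Ω → Fin N),
    IsSolution μ A lam C x₀ i₀ x θ →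
      ∫⁻ ω, ∫⁻ t in Ioi (0 : ℝ), ENNReal.ofReal (‖x t ω‖ ^ 2) ∂volume ∂μ < ⊤

/-- The closed loop matrices of `ẋ = A_θ x + B_θ u` under the mode-dependent state feedback
`u = F_θ x`. -/
def closedLoop {n m N : ℕ} (A : Fin N → Matrix (Fin n) (Fin n) ℝ)
    (B : Fin N → Matrix (Fin n) (Fin m) ℝ) (F : Fin N → Matrix (Fin m) (Fin n) ℝ) :
    Fin N → Matrix (Fin n) (Fin n) ℝ :=
  fun i => A i + B i * F i

/-- The block `J` of the linear matrix inequality for the region `κ` and the mode `i`. -/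
def blockJ {n m N K : ℕ} (A : Fin N → Matrix (Fin n) (Fin n) ℝ)
    (B : Fin N → Matrix (Fin n) (Fin m) ℝ) (lam : Fin K → Matrix (Fin N) (Fin N) ℝ)
    (X : Fin N → Matrix (Fin n) (Fin n) ℝ) (Y : Fin N → Matrix (Fin m) (Fin n) ℝ)
    (κ : Fin K) (i : Fin N) : Matrix (Fin n) (Fin n) ℝ :=
  X i * (A i)ᵀ + (Y i)ᵀ * (B i)ᵀ + A i * X i + B i * Y i
    + (∑ l : Fin K, lam l i i * if κ = l then 1 else 0) • X i

/-- The block row of the matrices `√(lam κ i j) X_i`, `j ≠ i`. -/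
noncomputable def blockM {n N K : ℕ} (lam : Fin K → Matrix (Fin N) (Fin N) ℝ)
    (X : Fin N → Matrix (Fin n) (Fin n) ℝ) (κ : Fin K) (i : Fin N) :
    Matrix (Fin n) (Fin n × {j : Fin N // j ≠ i}) ℝ :=
  Matrix.of fun a p => Real.sqrt (lam κ i p.2) * X i a p.1

/-- The block diagonal matrix with the diagonal blocks `X_j`, `j ≠ i`. -/
def blockX {n N : ℕ} (X : Fin N → Matrix (Fin n) (Fin n) ℝ) (i : Fin N) :
    Matrix (Fin n × {j : Fin N // j ≠ i}) (Fin n × {j : Fin N // j ≠ i}) ℝ :=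
  Matrix.blockDiagonal fun j : {j : Fin N // j ≠ i} => X j

end SDJLS

/-!
With `P i = (X i)⁻¹`, the function `V(v, i) = ⟪P i v, v⟫` is a stochastic Lyapunov function of the
closed loop. Evaluating the quadratic form of the matrix inequality at the vector with the blocks
`P i v` and `√(lam κ i j) P j v`, `j ≠ i`, which completes the square as in the Schur complement,
shows that the generator of the system maps `V` to a negative definite form in every mode and
every region (`lyapunov_neg_of_lmi`). By compactness of the unit sphere this form is at most
`-ε ‖v‖²` (`exists_forall_le_neg_mul_norm_sq`).

It remains to prove Dynkin's inequality `E V(x(t), θ(t)) + ε E ∫₀ᵗ ‖x‖² ≤ E V(x(0), θ(0))` from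
the transition rates, which are only given conditionally on the present state and mode. On a short
interval `[t, t + h]` the increment of `V` is split at the state `x(t)` and the mode `θ(t + h)`.
The change of the mode with the state frozen at `x(t)` is governed by the transition rates, and the
change of the state in the mode `θ(t + h)` by the differential equation. Replacing `x(t)` by `x(s)`
and `θ(t + h)` by `θ(s)` in the resulting time integrals over `s` costs `O(h²)` in the mean: the
state is Lipschitz in time, and the mode differs at two times with a probability at most
proportional to their distance (`IsJumpFlow.integral_mode_ne_le`). This gives the inequality on
`[t, t + h]` up to `c h²` (`IsJumpFlow.exists_integral_lyapunov_add_le`), and the errors vanish when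
`[0, τ]` is divided into ever more pieces (`le_of_forall_add_le_add_sq`). Since `V ≥ 0`, letting
`τ → ∞` proves stability (`IsJumpFlow.lintegral_norm_sq_lt_top`).

The estimates need Fubini's theorem, hence joint measurability in time and outcome. A solution has
regular paths only almost surely, so it is first changed on a null set
(`IsSolution.exists_isJumpFlow`).
-/

namespace SDJLS

/-! ### Jump flows with regular paths -/

section JumpFlow

variable {E ι Ω : Type*} [NormedAddCommGroup E] [InnerProductSpace ℝ E] [MeasurableSpace E]
  [MeasurableSpace ι] [DecidableEq ι] [MeasurableSpace Ω]

/-- A jump linear system `ẋ = T_θ x` with jump rates `r x i j`, in a general inner product space and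
with all path properties holding surely. The processes are jointly measurable on all of `ℝ × Ω`;
their values at negative times are irrelevant. The transition rates are encoded by testing against
functions `g` of the present state and mode, which replaces the conditional expectations. The
number `R` bounds the initial state. -/
structure IsJumpFlow (μ : Measure Ω) (T : ι → E →L[ℝ] E) (r : E → ι → ι → ℝ) (R : ℝ)
    (x : ℝ → Ω → E) (θ : ℝ → Ω → ι) : Prop where
  measurable_state : Measurable (Function.uncurry x)
  measurable_mode : Measurable (Function.uncurry θ)
  norm_init : ∀ ω, ‖x 0 ω‖ ≤ R
  continuousOn : ∀ ω, ContinuousOn (fun t => x t ω) (Ici 0)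
  deriv : ∀ ω t, 0 ≤ t → HasDerivWithinAt (fun s => x s ω) (T (θ t ω) (x t ω)) (Ici t) t
  rate : ∀ t h, 0 ≤ t → 0 ≤ h → ∀ (j : ι) (g : E × ι → ℝ), Measurable g →
    (∃ c, ∀ ω, |g (x t ω, θ t ω)| ≤ c) →
    ∫ ω, g (x t ω, θ t ω) * (if θ (t + h) ω = j then 1 else 0) ∂μ =
      ∫ ω, g (x t ω, θ t ω) * ((if θ t ω = j then 1 else 0) +
        ∫ s in t..(t + h), r (x s ω) (θ s ω) j) ∂μ

theorem intervalIntegrable_of_abs_le {f : ℝ → ℝ} {t u c : ℝ} (htu : t ≤ u) (hf : Measurable f)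
    (hc : ∀ s ∈ Icc t u, |f s| ≤ c) : IntervalIntegrable f volume t u := by
  rw [intervalIntegrable_iff_integrableOn_Icc_of_le htu]
  refine Measure.integrableOn_of_bounded (M := c) (by simp) hf.aestronglyMeasurable ?_
  exact (ae_restrict_iff' measurableSet_Icc).2 (Eventually.of_forall hc)

theorem measurable_intervalIntegral {f : ℝ → Ω → ℝ} (hf : Measurable (Function.uncurry f))
    {t u : ℝ} (htu : t ≤ u) : Measurable fun ω => ∫ s in t..u, f s ω := by
  simp only [intervalIntegral.integral_of_le htu]
  exact (hf.stronglyMeasurable.integral_prod_left (μ := volume.restrict (Ioc t u))).measurable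

theorem abs_intervalIntegral_le {f : ℝ → ℝ} {t u c : ℝ} (htu : t ≤ u)
    (hc : ∀ s ∈ Icc t u, |f s| ≤ c) : |∫ s in t..u, f s| ≤ c * (u - t) := by
  have := intervalIntegral.norm_integral_le_of_norm_le_const (a := t) (b := u) (f := f) (C := c)
    (fun s hs => hc s (by rw [uIoc_of_le htu] at hs; exact Ioc_subset_Icc_self hs))
  rwa [abs_of_nonneg (sub_nonneg.2 htu)] at this

theorem integrable_intervalIntegral {μ : Measure Ω} [IsFiniteMeasure μ] {f : ℝ → Ω → ℝ}
    (hf : Measurable (Function.uncurry f)) {t u c : ℝ} (htu : t ≤ u)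
    (hc : ∀ ω, ∀ s ∈ Icc t u, |f s ω| ≤ c) : Integrable (fun ω => ∫ s in t..u, f s ω) μ :=
  Integrable.of_bound (measurable_intervalIntegral hf htu).aestronglyMeasurable (c * (u - t))
    (Eventually.of_forall fun ω => abs_intervalIntegral_le htu (hc ω))

/-- A function whose increments over intervals of length `h` are at most `C h²` does not increase:
sum over `n` equal pieces and let `n → ∞`. -/
theorem le_of_forall_add_le_add_sq {Ψ : ℝ → ℝ} {T C : ℝ} (hT : 0 ≤ T)
    (h : ∀ t h, 0 ≤ t → 0 ≤ h → t + h ≤ T → Ψ (t + h) ≤ Ψ t + C * h ^ 2) : Ψ T ≤ Ψ 0 := by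
  have key : ∀ n : ℕ, 0 < n → Ψ T ≤ Ψ 0 + C * T ^ 2 / n := by
    intro n hn
    have hn' : (0 : ℝ) < n := by exact_mod_cast hn
    -- Only the grid points `k T / n` with `k ≤ n` stay inside `[0, T]`.
    have ind : ∀ k : ℕ, k ≤ n → Ψ (k * (T / n)) ≤ Ψ 0 + k * (C * (T / n) ^ 2) := by
      intro k
      induction k with
      | zero => intro _; simp
      | succ k ih =>
        intro hk
        have h1 := ih (by omega)
        have hk' : (k : ℝ) + 1 ≤ n := by exact_mod_cast hk
        have h2 := h (k * (T / n)) (T / n) (by positivity) (by positivity) (by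
          calc k * (T / n) + T / n = (k + 1) * (T / n) := by ring
            _ ≤ n * (T / n) := by gcongr
            _ = T := by field_simp)
        push_cast
        rw [show ((k : ℝ) + 1) * (T / n) = k * (T / n) + T / n by ring]
        linarith
    have := ind n le_rfl
    rw [show (n : ℝ) * (T / n) = T by field_simp] at this
    refine this.trans (le_of_eq ?_)
    field_simp
  have hlim : Tendsto (fun n : ℕ => Ψ 0 + C * T ^ 2 / n) atTop (𝓝 (Ψ 0 + 0)) :=
    tendsto_const_nhds.add (tendsto_const_div_atTop_nhds_zero_nat _)
  rw [add_zero] at hlim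
  exact ge_of_tendsto hlim (eventually_atTop.2 ⟨1, fun n hn => key n hn⟩)

namespace IsJumpFlow

variable {μ : Measure Ω} {T : ι → E →L[ℝ] E} {r : E → ι → ι → ℝ} {R : ℝ}
  {x : ℝ → Ω → E} {θ : ℝ → Ω → ι}

theorem measurable_state_at (hx : IsJumpFlow μ T r R x θ) (t : ℝ) : Measurable (x t) :=
  hx.measurable_state.comp measurable_prodMk_left

theorem measurable_mode_at (hx : IsJumpFlow μ T r R x θ) (t : ℝ) : Measurable (θ t) :=
  hx.measurable_mode.comp measurable_prodMk_left

/-- Grönwall's bound for the state. It is uniform in the outcome, so every quantity on a bounded time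
interval is bounded, hence integrable. -/
theorem norm_state_le (hx : IsJumpFlow μ T r R x θ) {M : ℝ} (hM0 : 0 ≤ M)
    (hM : ∀ i v, ‖T i v‖ ≤ M * ‖v‖) {τ t : ℝ} (ht : t ∈ Icc 0 τ) (ω : Ω) :
    ‖x t ω‖ ≤ R * Real.exp (M * τ) := by
  have h := norm_le_gronwallBound_of_norm_deriv_right_le (f := fun s => x s ω)
    (f' := fun s => T (θ s ω) (x s ω)) (δ := R) (K := M) (ε := 0) (a := 0) (b := τ)
    ((hx.continuousOn ω).mono Icc_subset_Ici_self) (fun s hs => hx.deriv ω s hs.1)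
    (hx.norm_init ω) (fun s _ => by simpa using hM _ _) t ht
  rw [gronwallBound_ε0, sub_zero] at h
  have hR : 0 ≤ R := (norm_nonneg _).trans (hx.norm_init ω)
  refine h.trans ?_
  have := ht.2
  gcongr

theorem norm_state_sub_le (hx : IsJumpFlow μ T r R x θ) {M : ℝ} (hM0 : 0 ≤ M)
    (hM : ∀ i v, ‖T i v‖ ≤ M * ‖v‖) {τ s t : ℝ} (hs : 0 ≤ s) (hst : s ≤ t) (ht : t ≤ τ) (ω : Ω) :
    ‖x t ω - x s ω‖ ≤ M * (R * Real.exp (M * τ)) * (t - s) := by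
  refine norm_image_sub_le_of_norm_deriv_right_le_segment (f := fun s => x s ω)
    (f' := fun s => T (θ s ω) (x s ω)) (a := s) (b := t)
    ((hx.continuousOn ω).mono fun a ha => hs.trans ha.1)
    (fun a ha => hx.deriv ω a (hs.trans ha.1)) (fun a ha => (hM _ _).trans ?_) t
    (right_mem_Icc.2 hst)
  gcongr
  exact hx.norm_state_le hM0 hM ⟨hs.trans ha.1, ha.2.le.trans ht⟩ ω

end IsJumpFlow
end JumpFlow

/-! ### Dissipation of the expected Lyapunov function -/

section Quadratic

variable {E : Type*} [NormedAddCommGroup E] [InnerProductSpace ℝ E]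

theorem abs_inner_self_sub_inner_self_le {S : E →L[ℝ] E} {b : ℝ} (hb : ∀ v, ‖S v‖ ≤ b * ‖v‖)
    (v w : E) : |inner ℝ (S v) v - inner ℝ (S w) w| ≤ b * ‖v - w‖ * (‖v‖ + ‖w‖) := by
  have h : inner ℝ (S v) v - inner ℝ (S w) w = inner ℝ (S v) (v - w) + inner ℝ (S (v - w)) w := by
    simp only [map_sub, inner_sub_left, inner_sub_right]; ring
  rw [h]
  calc _ ≤ |inner ℝ (S v) (v - w)| + |inner ℝ (S (v - w)) w| := abs_add_le _ _
    _ ≤ ‖S v‖ * ‖v - w‖ + ‖S (v - w)‖ * ‖w‖ :=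
        add_le_add (abs_real_inner_le_norm _ _) (abs_real_inner_le_norm _ _)
    _ ≤ (b * ‖v‖) * ‖v - w‖ + (b * ‖v - w‖) * ‖w‖ := by gcongr <;> exact hb _
    _ = _ := by ring

theorem abs_inner_self_le {S : E →L[ℝ] E} {b : ℝ} (hb : ∀ v, ‖S v‖ ≤ b * ‖v‖) (v : E) :
    |inner ℝ (S v) v| ≤ b * ‖v‖ ^ 2 := by
  simpa [sq, mul_assoc] using abs_inner_self_sub_inner_self_le hb v 0

theorem exists_forall_norm_apply_le {ι : Type*} [Fintype ι] (T : ι → E →L[ℝ] E) :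
    ∃ M, 0 ≤ M ∧ ∀ i v, ‖T i v‖ ≤ M * ‖v‖ := by
  refine ⟨∑ i, ‖T i‖, by positivity, fun i v => ((T i).le_opNorm v).trans ?_⟩
  gcongr
  exact Finset.single_le_sum (f := fun i => ‖T i‖) (fun _ _ => norm_nonneg _) (Finset.mem_univ i)

end Quadratic

section Dissipation

variable {E ι Ω : Type*} [NormedAddCommGroup E] [InnerProductSpace ℝ E] [MeasurableSpace E]
  [MeasurableSpace ι] [DecidableEq ι] [MeasurableSpace Ω]

namespace IsJumpFlow

variable {μ : Measure Ω} {T : ι → E →L[ℝ] E} {r : E → ι → ι → ℝ} {R : ℝ}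
  {x : ℝ → Ω → E} {θ : ℝ → Ω → ι}

/-- The modes at times `s ≤ u` differ with probability at most proportional to `u - s`. This is the
rate identity tested against the indicator of `θ s ≠ j`, summed over `j`. -/
theorem integral_mode_ne_le [IsProbabilityMeasure μ] [Fintype ι] [DiscreteMeasurableSpace ι]
    (hx : IsJumpFlow μ T r R x θ) {Λ : ℝ} (hr : ∀ v i j, |r v i j| ≤ Λ)
    {s u : ℝ} (hs : 0 ≤ s) (hsu : s ≤ u) :
    ∫ ω, (if θ s ω = θ u ω then (0 : ℝ) else 1) ∂μ ≤ Fintype.card ι * (Λ * (u - s)) := by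
  have hsplit : ∀ ω, (if θ s ω = θ u ω then (0 : ℝ) else 1) =
      ∑ j, (if θ s ω = j then (0 : ℝ) else 1) * (if θ (s + (u - s)) ω = j then 1 else 0) := by
    intro ω
    rw [add_sub_cancel, Finset.sum_eq_single (θ u ω)]
    · simp
    · intro j _ hj
      simp [hj.symm]
    · simp
  have hm : ∀ (a : ℝ) (j : ι) (c d : ℝ), Measurable fun ω => if θ a ω = j then c else d :=
    fun a j c d => (Measurable.of_discrete (f := fun i : ι => if i = j then c else d)).comp
      (hx.measurable_mode_at a)
  simp only [hsplit]
  rw [integral_finsetSum]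
  · calc _ ≤ ∑ _j : ι, Λ * (u - s) := by
          refine Finset.sum_le_sum fun j _ => ?_
          rw [hx.rate s (u - s) hs (sub_nonneg.2 hsu) j (fun p => if p.2 = j then 0 else 1)
            ((Measurable.of_discrete (f := fun i : ι => if i = j then (0 : ℝ) else 1)).comp
              measurable_snd) ⟨1, fun ω => by simp only; split_ifs <;> simp⟩]
          refine (le_abs_self _).trans ?_
          have hΛ : 0 ≤ Λ := (abs_nonneg _).trans (hr 0 j j)
          have := norm_integral_le_of_norm_le_const (μ := μ) (C := Λ * (u - s))
            (f := fun ω => (if θ s ω = j then (0 : ℝ) else 1) * ((if θ s ω = j then 1 else 0) +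
              ∫ a in s..(s + (u - s)), r (x a ω) (θ a ω) j)) (Eventually.of_forall fun ω => by
              by_cases h : θ s ω = j
              · simpa [h] using mul_nonneg hΛ (sub_nonneg.2 hsu)
              · simpa [h] using abs_intervalIntegral_le hsu fun a _ => hr (x a ω) (θ a ω) j)
          simpa using this
      _ = _ := by simp
  · intro j _
    refine Integrable.of_bound ((hm _ _ _ _).mul (hm _ _ _ _)).aestronglyMeasurable 1
      (Eventually.of_forall fun ω => ?_)
    split_ifs <;> simp

/-- The increment of a quadratic form of the state, with the mode of the form held fixed. -/
theorem integral_quadratic_deriv [Fintype ι] [DiscreteMeasurableSpace ι] [BorelSpace E]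
    [SecondCountableTopology E]
    (hx : IsJumpFlow μ T r R x θ) {S : E →L[ℝ] E}
    (hS : ∀ v w, inner ℝ (S v) w = inner ℝ v (S w)) {M : ℝ} (hM0 : 0 ≤ M)
    (hM : ∀ i v, ‖T i v‖ ≤ M * ‖v‖) {t u : ℝ} (ht : 0 ≤ t) (htu : t ≤ u) (ω : Ω) :
    ∫ s in t..u, 2 * inner ℝ (S (x s ω)) (T (θ s ω) (x s ω)) =
      inner ℝ (S (x u ω)) (x u ω) - inner ℝ (S (x t ω)) (x t ω) := by
  refine intervalIntegral.integral_eq_sub_of_hasDeriv_right_of_le_real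
    (g := fun s => inner ℝ (S (x s ω)) (x s ω)) htu ?_ ?_ ?_
  · have hc := (hx.continuousOn ω).mono (s := Ici 0) (t := Icc t u) fun a ha => ht.trans ha.1
    exact (S.continuous.comp_continuousOn hc).inner hc
  · intro s hs
    have hd := (hx.deriv ω s (ht.trans hs.1.le)).mono Ioi_subset_Ici_self
    have hSd := S.hasFDerivAt.comp_hasDerivWithinAt s hd
    refine (hSd.inner ℝ hd).congr_deriv ?_
    rw [Function.comp_apply, hS (T _ _), real_inner_comm (T _ _)]
    ring
  · have hmx : Measurable fun s => x s ω := hx.measurable_state.comp measurable_prodMk_right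
    have hmθ : Measurable fun s => θ s ω := hx.measurable_mode.comp measurable_prodMk_right
    have hG : Measurable fun p : E × ι => 2 * inner ℝ (S p.1) (T p.2 p.1) :=
      measurable_from_prod_countable_left fun i => by
        exact ((S.continuous.inner (T i).continuous).const_smul (2 : ℝ)).measurable
    refine (intervalIntegrable_iff_integrableOn_Icc_of_le htu).1
      (intervalIntegrable_of_abs_le (c := 2 * ((‖S‖ * (R * Real.exp (M * u))) *
        (M * (R * Real.exp (M * u))))) htu (hG.comp (hmx.prodMk hmθ)) fun s hs => ?_)
    have hb := hx.norm_state_le hM0 hM ⟨ht.trans hs.1, hs.2⟩ ω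
    have hR : 0 ≤ R := (norm_nonneg _).trans (hx.norm_init ω)
    simp only [abs_mul, abs_two]
    gcongr
    refine (abs_real_inner_le_norm _ _).trans ?_
    gcongr
    · exact (S.le_opNorm _).trans (by gcongr)
    · exact (hM _ _).trans (by gcongr)

/-- If the generator maps the Lyapunov function `⟪S i v, v⟫` below `-ε ‖v‖²`, then its expectation
decreases over `[t, t + h]` by `ε E ∫ ‖x‖²`, up to an error of order `h²` which is uniform on
`[0, τ]`. -/
theorem exists_integral_lyapunov_add_le [IsProbabilityMeasure μ] [Fintype ι]
    [DiscreteMeasurableSpace ι] [BorelSpace E] [SecondCountableTopology E]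
    (hx : IsJumpFlow μ T r R x θ) {S : ι → E →L[ℝ] E}
    (hS : ∀ i v w, inner ℝ (S i v) w = inner ℝ v (S i w)) {Λ ε : ℝ}
    (hrm : ∀ j, Measurable fun p : E × ι => r p.1 p.2 j) (hr : ∀ v i j, |r v i j| ≤ Λ)
    (hgen : ∀ i v, 2 * inner ℝ (S i v) (T i v) + ∑ j, r v i j * inner ℝ (S j v) v ≤ -ε * ‖v‖ ^ 2)
    (τ : ℝ) :
    ∃ c, ∀ t h, 0 ≤ t → 0 ≤ h → t + h ≤ τ →
      ∫ ω, inner ℝ (S (θ (t + h) ω) (x (t + h) ω)) (x (t + h) ω) ∂μ +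
          ε * ∫ ω, (∫ s in t..(t + h), ‖x s ω‖ ^ 2) ∂μ ≤
        ∫ ω, inner ℝ (S (θ t ω) (x t ω)) (x t ω) ∂μ + c * h ^ 2 := by
  obtain ⟨M, hM0, hM⟩ : ∃ M, 0 ≤ M ∧ ∀ i v, ‖T i v‖ ≤ M * ‖v‖ :=
    exists_forall_norm_apply_le T
  obtain ⟨b, hb0, hb⟩ : ∃ b, 0 ≤ b ∧ ∀ i v, ‖S i v‖ ≤ b * ‖v‖ :=
    exists_forall_norm_apply_le S
  obtain ⟨ω₀⟩ : Nonempty Ω := nonempty_of_isProbabilityMeasure μ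
  have hR : 0 ≤ R := (norm_nonneg _).trans (hx.norm_init ω₀)
  have hΛ : 0 ≤ Λ := (abs_nonneg _).trans (hr 0 (θ 0 ω₀) (θ 0 ω₀))
  set ρ := R * Real.exp (M * τ) with hρ
  have hρ0 : 0 ≤ ρ := by positivity
  obtain ⟨N, hN⟩ : ∃ N : ℝ, N = Fintype.card ι := ⟨_, rfl⟩
  have hN0 : 0 ≤ N := hN ▸ Nat.cast_nonneg _
  have hxb : ∀ s, 0 ≤ s → s ≤ τ → ∀ ω, ‖x s ω‖ ≤ ρ := fun s h0 h1 ω =>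
    hx.norm_state_le hM0 hM ⟨h0, h1⟩ ω
  set c₁ := 4 * (b * ρ * (M * ρ)) with hc₁
  have hc₁0 : 0 ≤ c₁ := by positivity
  set c₂ := N * (Λ * (b * (M * ρ) * (ρ + ρ))) with hc₂
  refine ⟨c₁ * (N * Λ) + c₂, fun t h ht hh hτ => ?_⟩
  set u := t + h with hu
  have htu : t ≤ u := by linarith
  have hmpair : Measurable fun p : ℝ × Ω => (x p.1 p.2, θ p.1 p.2) :=
    hx.measurable_state.prodMk hx.measurable_mode
  have hqm : ∀ j, Measurable fun v : E => inner ℝ (S j v) v := fun j =>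
    ((S j).continuous.inner continuous_id).measurable
  have hVm : Measurable fun p : ι × E => inner ℝ (S p.1 p.2) p.2 :=
    measurable_from_prod_countable_right fun i => hqm i
  have hmr : ∀ j, Measurable (Function.uncurry fun s ω => r (x s ω) (θ s ω) j) := fun j =>
    (hrm j).comp hmpair
  have hmD : Measurable (Function.uncurry fun s ω =>
      2 * inner ℝ (S (θ u ω) (x s ω)) (T (θ s ω) (x s ω))) := by
    have hG : Measurable fun p : ι × (E × ι) => 2 * inner ℝ (S p.1 p.2.1) (T p.2.2 p.2.1) :=
      measurable_from_prod_countable_right fun i => measurable_from_prod_countable_left fun j => by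
        exact (((S i).continuous.inner (T j).continuous).const_smul (2 : ℝ)).measurable
    exact hG.comp (((hx.measurable_mode_at u).comp measurable_snd).prodMk hmpair)
  have hmN : Measurable (Function.uncurry fun s ω => ‖x s ω‖ ^ 2) :=
    hx.measurable_state.norm.pow_const 2
  have hmne : Measurable (Function.uncurry fun s ω => if θ s ω = θ u ω then (0 : ℝ) else 1) := by
    have hG : Measurable fun p : ι × ι => if p.1 = p.2 then (0 : ℝ) else 1 := Measurable.of_discrete
    exact hG.comp (hx.measurable_mode.prodMk ((hx.measurable_mode_at u).comp measurable_snd))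
  have hbq : ∀ j s, 0 ≤ s → s ≤ τ → ∀ ω, |inner ℝ (S j (x s ω)) (x s ω)| ≤ b * ρ ^ 2 := by
    intro j s h0 h1 ω
    refine (abs_inner_self_le (hb j) _).trans ?_
    have := hxb s h0 h1 ω
    gcongr
  have hbD0 : ∀ i s, 0 ≤ s → s ≤ τ → ∀ ω,
      |inner ℝ (S i (x s ω)) (T (θ s ω) (x s ω))| ≤ b * ρ * (M * ρ) := by
    intro i s h0 h1 ω
    have := hxb s h0 h1 ω
    refine (abs_real_inner_le_norm _ _).trans ?_
    gcongr
    · exact (hb _ _).trans (by gcongr)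
    · exact (hM _ _).trans (by gcongr)
  have hbD : ∀ ω, ∀ s ∈ Icc t u, |2 * inner ℝ (S (θ u ω) (x s ω)) (T (θ s ω) (x s ω))| ≤
      2 * (b * ρ * (M * ρ)) := by
    intro ω s hs
    rw [abs_mul, abs_two]
    exact mul_le_mul_of_nonneg_left (hbD0 _ s (ht.trans hs.1) (hs.2.trans hτ) ω) zero_le_two
  have hbN : ∀ ω, ∀ s ∈ Icc t u, |‖x s ω‖ ^ 2| ≤ ρ ^ 2 := by
    intro ω s hs
    have := hxb s (ht.trans hs.1) (hs.2.trans hτ) ω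
    rw [abs_of_nonneg (by positivity)]
    gcongr
  have hbne : ∀ ω, ∀ s ∈ Icc t u, |if θ s ω = θ u ω then (0 : ℝ) else 1| ≤ 1 := by
    intro ω s _
    split_ifs <;> simp
  have hIq : ∀ (s s' : ℝ), 0 ≤ s → s ≤ τ →
      Integrable (fun ω => inner ℝ (S (θ s' ω) (x s ω)) (x s ω)) μ := fun s s' h0 h1 =>
    Integrable.of_bound (hVm.comp ((hx.measurable_mode_at s').prodMk
      (hx.measurable_state_at s))).aestronglyMeasurable _
      (Eventually.of_forall fun ω => hbq _ s h0 h1 ω)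
  have hIr : ∀ j, Integrable (fun ω => inner ℝ (S j (x t ω)) (x t ω) *
      ∫ s in t..u, r (x s ω) (θ s ω) j) μ := fun j =>
    Integrable.of_bound (((hqm j).comp (hx.measurable_state_at t)).mul
      (measurable_intervalIntegral (hmr j) htu)).aestronglyMeasurable
      ((b * ρ ^ 2) * (Λ * (u - t))) (Eventually.of_forall fun ω => by
        rw [norm_mul]
        exact mul_le_mul (hbq j t ht (htu.trans hτ) ω)
          (abs_intervalIntegral_le htu fun s _ => hr _ _ _) (norm_nonneg _) (by positivity))
  have hIi : ∀ (a : ℝ) (j : ι), Integrable (fun ω => inner ℝ (S j (x t ω)) (x t ω) *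
      (if θ a ω = j then 1 else 0)) μ := fun a j =>
    Integrable.of_bound (((hqm j).comp (hx.measurable_state_at t)).mul
      ((Measurable.of_discrete (f := fun i : ι => if i = j then (1 : ℝ) else 0)).comp
      (hx.measurable_mode_at a))).aestronglyMeasurable (b * ρ ^ 2)
      (Eventually.of_forall fun ω => by
        have := hbq j t ht (htu.trans hτ) ω
        split_ifs
        · simpa using this
        · simpa using (abs_nonneg _).trans this)
  -- The change of the mode while the state is frozen at time `t`: the coefficients
  -- `⟪S j (x t), x t⟫` are functions of the present state, so the rate identity applies to them.
  have hmode : ∫ ω, inner ℝ (S (θ u ω) (x t ω)) (x t ω) ∂μ =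
      ∫ ω, inner ℝ (S (θ t ω) (x t ω)) (x t ω) ∂μ +
        ∫ ω, (∑ j, inner ℝ (S j (x t ω)) (x t ω) * ∫ s in t..u, r (x s ω) (θ s ω) j) ∂μ := by
    have hsum : ∀ a ω, inner ℝ (S (θ a ω) (x t ω)) (x t ω) =
        ∑ j, inner ℝ (S j (x t ω)) (x t ω) * (if θ a ω = j then 1 else 0) := by
      intro a ω
      simp
    simp only [hsum]
    rw [integral_finsetSum _ fun j _ => hIi u j, integral_finsetSum _ fun j _ => hIi t j,
      integral_finsetSum _ fun j _ => hIr j, ← Finset.sum_add_distrib]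
    refine Finset.sum_congr rfl fun j _ => ?_
    rw [← integral_add (hIi t j) (hIr j), hu, hx.rate t h ht hh j
      (fun p => inner ℝ (S j p.1) p.1) ((hqm j).comp measurable_fst)
      ⟨_, fun ω => hbq j t ht (htu.trans hτ) ω⟩]
    simp only [mul_add]
  -- The first difference is the change of the state in the final mode `θ u`. Comparing the time
  -- integrands with the generator at `(x s, θ s)` costs `c₁` when `θ s ≠ θ u`, and `c₂ h` because
  -- the jump term has `x t` in place of `x s`.
  have hpath : ∀ ω, inner ℝ (S (θ u ω) (x u ω)) (x u ω) - inner ℝ (S (θ u ω) (x t ω)) (x t ω) +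
      ∑ j, inner ℝ (S j (x t ω)) (x t ω) * ∫ s in t..u, r (x s ω) (θ s ω) j ≤
      -ε * (∫ s in t..u, ‖x s ω‖ ^ 2) +
        c₁ * (∫ s in t..u, if θ s ω = θ u ω then (0 : ℝ) else 1) + c₂ * h ^ 2 := by
    intro ω
    have hsec : ∀ {f : ℝ → Ω → ℝ}, Measurable (Function.uncurry f) → Measurable fun s => f s ω :=
      fun hf => hf.comp measurable_prodMk_right
    have iD := intervalIntegrable_of_abs_le htu (hsec hmD) (hbD ω)
    have iN := intervalIntegrable_of_abs_le htu (hsec hmN) (hbN ω)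
    have ine := intervalIntegrable_of_abs_le htu (hsec hmne) (hbne ω)
    have ir : ∀ j, IntervalIntegrable (fun s => r (x s ω) (θ s ω) j) volume t u := fun j =>
      intervalIntegrable_of_abs_le htu (hsec (hmr j)) fun s _ => hr _ _ _
    rw [← hx.integral_quadratic_deriv (hS (θ u ω)) hM0 hM ht htu ω]
    have isum : IntervalIntegrable (fun s => ∑ j, inner ℝ (S j (x t ω)) (x t ω) *
        r (x s ω) (θ s ω) j) volume t u := by
      have := IntervalIntegrable.sum (μ := volume) (a := t) (b := u) Finset.univ
        (f := fun j s => inner ℝ (S j (x t ω)) (x t ω) * r (x s ω) (θ s ω) j)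
        fun j _ => (ir j).const_mul _
      simpa [Finset.sum_fn] using this
    have e1 : ∑ j, inner ℝ (S j (x t ω)) (x t ω) * ∫ s in t..u, r (x s ω) (θ s ω) j =
        ∫ s in t..u, ∑ j, inner ℝ (S j (x t ω)) (x t ω) * r (x s ω) (θ s ω) j := by
      rw [intervalIntegral.integral_finsetSum fun j _ => (ir j).const_mul _]
      simp
    have e2 : c₂ * h ^ 2 = ∫ _s in t..u, c₂ * h := by
      rw [intervalIntegral.integral_const, hu, smul_eq_mul]; ring
    rw [e1, ← intervalIntegral.integral_add iD isum, e2, ← intervalIntegral.integral_const_mul,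
      ← intervalIntegral.integral_const_mul,
      ← intervalIntegral.integral_add (iN.const_mul _) (ine.const_mul _),
      ← intervalIntegral.integral_add ((iN.const_mul _).add (ine.const_mul _)) (by simp)]
    refine intervalIntegral.integral_mono_on htu (iD.add isum)
      (((iN.const_mul _).add (ine.const_mul _)).add (by simp)) fun s hs => ?_
    have hs0 : 0 ≤ s := ht.trans hs.1
    have hsτ : s ≤ τ := hs.2.trans hτ
    have hg := hgen (θ s ω) (x s ω)
    have h1 : 2 * inner ℝ (S (θ u ω) (x s ω)) (T (θ s ω) (x s ω)) ≤
        2 * inner ℝ (S (θ s ω) (x s ω)) (T (θ s ω) (x s ω)) +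
          c₁ * (if θ s ω = θ u ω then 0 else 1) := by
      by_cases hθ : θ s ω = θ u ω
      · simp [hθ]
      · have ha := abs_le.1 (hbD0 (θ u ω) s hs0 hsτ ω)
        have hb := abs_le.1 (hbD0 (θ s ω) s hs0 hsτ ω)
        simp only [hθ, if_false, mul_one]
        linarith
    have h2 : ∑ j, inner ℝ (S j (x t ω)) (x t ω) * r (x s ω) (θ s ω) j ≤
        ∑ j, r (x s ω) (θ s ω) j * inner ℝ (S j (x s ω)) (x s ω) + c₂ * h := by
      have e3 : c₂ * h = ∑ _j : ι, Λ * (b * (M * ρ * h) * (ρ + ρ)) := by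
        simp [hc₂, hN]; ring
      rw [e3, ← Finset.sum_add_distrib]
      refine Finset.sum_le_sum fun j _ => ?_
      have hd : ‖x t ω - x s ω‖ ≤ M * ρ * h := by
        rw [norm_sub_rev]
        refine (hx.norm_state_sub_le hM0 hM ht hs.1 hsτ ω).trans ?_
        have : s - t ≤ h := by linarith [hs.2]
        gcongr
      have hq : |inner ℝ (S j (x t ω)) (x t ω) - inner ℝ (S j (x s ω)) (x s ω)| ≤
          b * (M * ρ * h) * (ρ + ρ) := by
        refine (abs_inner_self_sub_inner_self_le (hb j) _ _).trans ?_
        have := hxb s hs0 hsτ ω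
        have := hxb t ht (htu.trans hτ) ω
        gcongr
      have hp : r (x s ω) (θ s ω) j *
          (inner ℝ (S j (x t ω)) (x t ω) - inner ℝ (S j (x s ω)) (x s ω)) ≤
          Λ * (b * (M * ρ * h) * (ρ + ρ)) := by
        refine (le_abs_self _).trans ?_
        rw [abs_mul]
        exact mul_le_mul (hr _ _ _) hq (abs_nonneg _) hΛ
      linarith
    linarith
  -- The expected time spent away from the final mode is of second order.
  have hne : ∫ ω, (∫ s in t..u, if θ s ω = θ u ω then (0 : ℝ) else 1) ∂μ ≤ N * Λ * h ^ 2 := by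
    simp only [intervalIntegral.integral_of_le htu]
    rw [integral_integral_swap]
    · rw [← intervalIntegral.integral_of_le htu]
      have hle : ∀ s ∈ Icc t u, ∫ ω, (if θ s ω = θ u ω then (0 : ℝ) else 1) ∂μ ≤ N * (Λ * h) := by
        intro s hs
        rw [hN]
        refine (hx.integral_mode_ne_le hr (ht.trans hs.1) hs.2).trans ?_
        have : u - s ≤ h := by linarith [hs.1]
        gcongr
      have := abs_intervalIntegral_le htu (f := fun s =>
        ∫ ω, (if θ s ω = θ u ω then (0 : ℝ) else 1) ∂μ) (c := N * (Λ * h)) fun s hs => by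
          rw [abs_of_nonneg (integral_nonneg fun ω => by simp only; split_ifs <;> simp)]
          exact hle s hs
      refine (le_abs_self _).trans (this.trans (le_of_eq ?_))
      rw [hu]; ring
    · refine Integrable.of_bound (C := 1)
        (hmne.comp measurable_swap).aestronglyMeasurable (Eventually.of_forall fun p => ?_)
      simp only [Function.uncurry]
      split_ifs <;> simp
  have hIN := integrable_intervalIntegral (μ := μ) hmN htu hbN
  have hIne := integrable_intervalIntegral (μ := μ) hmne htu hbne
  have hIu := hIq u u (ht.trans htu) hτ
  have hIt := hIq t u ht (htu.trans hτ)
  have hId : Integrable (fun ω => inner ℝ (S (θ u ω) (x u ω)) (x u ω) -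
      inner ℝ (S (θ u ω) (x t ω)) (x t ω)) μ := hIu.sub hIt
  have hIs : Integrable (fun ω => ∑ j, inner ℝ (S j (x t ω)) (x t ω) *
      ∫ s in t..u, r (x s ω) (θ s ω) j) μ := integrable_finsetSum Finset.univ fun j _ => hIr j
  have hIb : Integrable (fun ω => -ε * (∫ s in t..u, ‖x s ω‖ ^ 2) +
      c₁ * (∫ s in t..u, if θ s ω = θ u ω then (0 : ℝ) else 1)) μ :=
    (hIN.const_mul (-ε)).add (hIne.const_mul c₁)
  have hmono := integral_mono (hId.add hIs) (hIb.add (integrable_const (c₂ * h ^ 2))) hpath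
  simp only [Pi.add_apply] at hmono
  rw [integral_add hId hIs, integral_sub hIu hIt, integral_add hIb (integrable_const _),
    integral_add (hIN.const_mul (-ε)) (hIne.const_mul c₁), integral_const_mul,
    integral_const_mul, integral_const, probReal_univ, one_smul, hmode] at hmono
  have := mul_le_mul_of_nonneg_left hne hc₁0
  linarith

/-- A jump flow with a nonnegative quadratic Lyapunov function, decreasing at a rate of at least
`ε ‖v‖²`, is mean square integrable over time. -/
theorem lintegral_norm_sq_lt_top [IsProbabilityMeasure μ] [Fintype ι]
    [DiscreteMeasurableSpace ι] [BorelSpace E] [SecondCountableTopology E]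
    (hx : IsJumpFlow μ T r R x θ) {S : ι → E →L[ℝ] E}
    (hS : ∀ i v w, inner ℝ (S i v) w = inner ℝ v (S i w)) (hS0 : ∀ i v, 0 ≤ inner ℝ (S i v) v)
    {Λ ε : ℝ} (hε : 0 < ε)
    (hrm : ∀ j, Measurable fun p : E × ι => r p.1 p.2 j) (hr : ∀ v i j, |r v i j| ≤ Λ)
    (hgen : ∀ i v,
      2 * inner ℝ (S i v) (T i v) + ∑ j, r v i j * inner ℝ (S j v) v ≤ -ε * ‖v‖ ^ 2) :
    ∫⁻ ω, ∫⁻ t in Ioi (0 : ℝ), ENNReal.ofReal (‖x t ω‖ ^ 2) ∂volume ∂μ < ⊤ := by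
  set Φ : ℝ → ℝ := fun t => ∫ ω, inner ℝ (S (θ t ω) (x t ω)) (x t ω) ∂μ with hΦ
  obtain ⟨M, hM0, hM⟩ : ∃ M, 0 ≤ M ∧ ∀ i v, ‖T i v‖ ≤ M * ‖v‖ :=
    exists_forall_norm_apply_le T
  have hmN : Measurable (Function.uncurry fun s ω => ‖x s ω‖ ^ 2) :=
    hx.measurable_state.norm.pow_const 2
  have hbN : ∀ τ ω, ∀ s ∈ Icc 0 τ, |‖x s ω‖ ^ 2| ≤ (R * Real.exp (M * τ)) ^ 2 := by
    intro τ ω s hs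
    have := hx.norm_state_le hM0 hM hs ω
    rw [abs_of_nonneg (by positivity)]
    gcongr
  have hint : ∀ τ ω a b, 0 ≤ a → a ≤ b → b ≤ τ →
      IntervalIntegrable (fun s => ‖x s ω‖ ^ 2) volume a b := fun τ ω a b ha hab hb =>
    intervalIntegrable_of_abs_le hab (hmN.comp measurable_prodMk_right) fun s hs =>
      hbN τ ω s ⟨ha.trans hs.1, hs.2.trans hb⟩
  have hbound : ∀ τ, 0 ≤ τ → ∫ ω, (∫ s in (0 : ℝ)..τ, ‖x s ω‖ ^ 2) ∂μ ≤ Φ 0 / ε := by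
    intro τ hτ
    obtain ⟨c, hc⟩ := hx.exists_integral_lyapunov_add_le hS hrm hr hgen τ
    have hle := le_of_forall_add_le_add_sq (C := c) hτ
      (Ψ := fun t => Φ t + ε * ∫ ω, (∫ s in (0 : ℝ)..t, ‖x s ω‖ ^ 2) ∂μ) fun t h ht hh hth => by
        have hsplit : ∫ ω, (∫ s in (0 : ℝ)..(t + h), ‖x s ω‖ ^ 2) ∂μ =
            ∫ ω, (∫ s in (0 : ℝ)..t, ‖x s ω‖ ^ 2) ∂μ +
              ∫ ω, (∫ s in t..(t + h), ‖x s ω‖ ^ 2) ∂μ := by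
          rw [← integral_add
            (integrable_intervalIntegral hmN ht fun ω s hs => hbN t ω s hs)
            (integrable_intervalIntegral hmN (by linarith) fun ω s hs =>
              hbN (t + h) ω s ⟨ht.trans hs.1, hs.2⟩)]
          refine integral_congr_ae (Eventually.of_forall fun ω => ?_)
          exact (intervalIntegral.integral_add_adjacent_intervals
            (hint t ω 0 t le_rfl ht le_rfl)
            (hint (t + h) ω t (t + h) ht (by linarith) le_rfl)).symm
        have := hc t h ht hh hth
        simp only [hsplit, hΦ]
        linarith
    have h0 : 0 ≤ Φ τ := integral_nonneg fun ω => hS0 _ _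
    simp only [intervalIntegral.integral_same, integral_zero, mul_zero, add_zero] at hle
    rw [le_div_iff₀ hε]
    linarith
  have hmE : Measurable (Function.uncurry fun s ω => ENNReal.ofReal (‖x s ω‖ ^ 2)) :=
    hmN.ennreal_ofReal
  have hfin : ∀ τ, 0 ≤ τ → ∫⁻ ω, ∫⁻ t in Ioc 0 τ, ENNReal.ofReal (‖x t ω‖ ^ 2) ∂volume ∂μ ≤
      ENNReal.ofReal (Φ 0 / ε) := by
    intro τ hτ
    refine le_trans (le_of_eq ?_) (ENNReal.ofReal_le_ofReal (hbound τ hτ))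
    rw [ofReal_integral_eq_lintegral_ofReal (integrable_intervalIntegral hmN hτ (hbN τ))
      (Eventually.of_forall fun ω => intervalIntegral.integral_nonneg hτ fun _ _ => by positivity)]
    refine lintegral_congr fun ω => ?_
    rw [intervalIntegral.integral_of_le hτ, ofReal_integral_eq_lintegral_ofReal
      ((intervalIntegrable_iff_integrableOn_Ioc_of_le hτ).1 (hint τ ω 0 τ le_rfl hτ le_rfl))
      (Eventually.of_forall fun _ => by positivity)]
  -- Monotone convergence along `[0, k]`.
  have hU : Ioi (0 : ℝ) = ⋃ k : ℕ, Ioc 0 (k : ℝ) := by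
    ext s
    simp only [mem_Ioi, mem_iUnion, mem_Ioc]
    exact ⟨fun hs => (exists_nat_ge s).imp fun k hk => ⟨hs, hk⟩, fun ⟨_, hs, _⟩ => hs⟩
  have hmono : Monotone fun k : ℕ => Ioc (0 : ℝ) k := fun a b hab =>
    Ioc_subset_Ioc_right (by exact_mod_cast hab)
  have hmk : ∀ k : ℕ, Measurable fun ω =>
      ∫⁻ t in Ioc (0 : ℝ) k, ENNReal.ofReal (‖x t ω‖ ^ 2) := fun k =>
    (hmE.comp measurable_swap).lintegral_prod_right'
  refine lt_of_le_of_lt ?_ (ENNReal.ofReal_lt_top (r := Φ 0 / ε))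
  simp only [hU, setLIntegral_iUnion_of_directed _ hmono.directed_le]
  rw [lintegral_iSup hmk fun a b hab ω => lintegral_mono_set (hmono hab)]
  exact iSup_le fun k => hfin k k.cast_nonneg

end IsJumpFlow
end Dissipation

/-! ### The Lyapunov inequality from the linear matrix inequality -/

section LMI

variable {n m N K : ℕ}

theorem blockM_mulVec (lam : Fin K → Matrix (Fin N) (Fin N) ℝ)
    (X : Fin N → Matrix (Fin n) (Fin n) ℝ) (κ : Fin K) (i : Fin N)
    (w : {j : Fin N // j ≠ i} → Fin n → ℝ) :
    blockM lam X κ i *ᵥ (fun p => w p.2 p.1) =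
      ∑ j : {j : Fin N // j ≠ i}, Real.sqrt (lam κ i j) • X i *ᵥ w j := by
  ext a
  simp [blockM, Matrix.mulVec, dotProduct, Fintype.sum_prod_type_right, Finset.mul_sum, mul_assoc]

theorem blockX_mulVec (X : Fin N → Matrix (Fin n) (Fin n) ℝ) (i : Fin N)
    (w : {j : Fin N // j ≠ i} → Fin n → ℝ) :
    blockX X i *ᵥ (fun p => w p.2 p.1) = fun p => (X p.2 *ᵥ w p.2) p.1 := by
  ext ⟨a, j⟩
  simp [blockX, Matrix.mulVec, dotProduct, Fintype.sum_prod_type_right,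
    Matrix.blockDiagonal_apply, ite_mul]

/-- The linear matrix inequality makes the generator negative on the Lyapunov function with the
matrices `(X i)⁻¹`. -/
theorem lyapunov_neg_of_lmi (A : Fin N → Matrix (Fin n) (Fin n) ℝ)
    (B : Fin N → Matrix (Fin n) (Fin m) ℝ) {lam : Fin K → Matrix (Fin N) (Fin N) ℝ}
    (hlam : IsRateFamily lam) {X : Fin N → Matrix (Fin n) (Fin n) ℝ}
    (Y : Fin N → Matrix (Fin m) (Fin n) ℝ) (hX : ∀ i, (X i).PosDef) {κ : Fin K} {i : Fin N}
    (hLMI : (-(Matrix.fromBlocks (blockJ A B lam X Y κ i) (blockM lam X κ i)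
      (blockM lam X κ i)ᵀ (-(blockX X i)))).PosDef) {v : Fin n → ℝ} (hv : v ≠ 0) :
    2 * (((X i)⁻¹ *ᵥ v) ⬝ᵥ (closedLoop A B (fun i => Y i * (X i)⁻¹) i *ᵥ v)) +
      ∑ j, lam κ i j * (((X j)⁻¹ *ᵥ v) ⬝ᵥ v) < 0 := by
  have hXP : ∀ j, X j *ᵥ ((X j)⁻¹ *ᵥ v) = v := fun j => by
    rw [Matrix.mulVec_mulVec, Matrix.mul_nonsing_inv _ ((Matrix.isUnit_iff_isUnit_det _).1
      (hX j).isUnit), Matrix.one_mulVec]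
  have hXT : (X i)ᵀ = X i := by simpa using (hX i).isHermitian.eq
  set u := (X i)⁻¹ *ᵥ v with hu
  have hXu : X i *ᵥ u = v := hXP i
  have huX : u ᵥ* X i = v := by rw [← Matrix.mulVec_transpose, hXT, hXu]
  set w : {j : Fin N // j ≠ i} → Fin n → ℝ :=
    fun j => Real.sqrt (lam κ i j) • ((X j)⁻¹ *ᵥ v) with hw
  -- The test vector has the blocks `u` and `w j`; it is nonzero because `X i u = v ≠ 0`.
  have hz : Sum.elim u (fun p : Fin n × {j : Fin N // j ≠ i} => w p.2 p.1) ≠ 0 := by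
    intro h
    refine hv ?_
    have hu0 : u = 0 := funext fun a => congrFun h (Sum.inl a)
    rw [← hXu, hu0, Matrix.mulVec_zero]
  have hpos := hLMI.dotProduct_mulVec_pos hz
  rw [star_trivial, Matrix.neg_mulVec, dotProduct_neg, Matrix.fromBlocks_mulVec] at hpos
  simp only [Sum.elim_comp_inl, Sum.elim_comp_inr, sumElim_dotProduct_sumElim, dotProduct_add,
    Matrix.neg_mulVec, dotProduct_neg] at hpos
  -- The rates with `j ≠ i` are nonnegative, so the square root has no junk value here.
  have hsq : ∀ j : {j : Fin N // j ≠ i}, Real.sqrt (lam κ i j) * Real.sqrt (lam κ i j) =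
      lam κ i j := fun j => Real.mul_self_sqrt (hlam.nonneg κ i j j.2.symm)
  have hM : u ⬝ᵥ (blockM lam X κ i *ᵥ fun p => w p.2 p.1) =
      ∑ j : {j : Fin N // j ≠ i}, lam κ i j * (((X j)⁻¹ *ᵥ v) ⬝ᵥ v) := by
    rw [blockM_mulVec, dotProduct_sum]
    refine Finset.sum_congr rfl fun j _ => ?_
    rw [hw, dotProduct_smul, Matrix.mulVec_smul, dotProduct_smul, Matrix.dotProduct_mulVec, huX,
      smul_eq_mul, smul_eq_mul, ← mul_assoc, hsq, dotProduct_comm]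
  have hMT : (fun p : Fin n × {j : Fin N // j ≠ i} => w p.2 p.1) ⬝ᵥ ((blockM lam X κ i)ᵀ *ᵥ u) =
      u ⬝ᵥ (blockM lam X κ i *ᵥ fun p => w p.2 p.1) := by
    rw [Matrix.mulVec_transpose, Matrix.dotProduct_mulVec, dotProduct_comm]
  have hD : (fun p : Fin n × {j : Fin N // j ≠ i} => w p.2 p.1) ⬝ᵥ
      (blockX X i *ᵥ fun p => w p.2 p.1) =
      ∑ j : {j : Fin N // j ≠ i}, lam κ i j * (((X j)⁻¹ *ᵥ v) ⬝ᵥ v) := by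
    rw [blockX_mulVec, dotProduct, Fintype.sum_prod_type_right]
    refine Finset.sum_congr rfl fun j _ => ?_
    change w j ⬝ᵥ (X j *ᵥ w j) = _
    rw [hw, Matrix.mulVec_smul, hXP, smul_dotProduct, dotProduct_smul, smul_eq_mul, smul_eq_mul,
      ← mul_assoc, hsq]
  have hJ : u ⬝ᵥ (blockJ A B lam X Y κ i *ᵥ u) =
      2 * (u ⬝ᵥ (closedLoop A B (fun i => Y i * (X i)⁻¹) i *ᵥ v)) + lam κ i i * (u ⬝ᵥ v) := by
    have h1 : u ⬝ᵥ ((X i * (A i)ᵀ) *ᵥ u) = u ⬝ᵥ (A i *ᵥ v) := by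
      rw [← Matrix.mulVec_mulVec, Matrix.dotProduct_mulVec, huX, Matrix.mulVec_transpose,
        Matrix.dotProduct_mulVec, dotProduct_comm]
    have h2 : u ⬝ᵥ (((Y i)ᵀ * (B i)ᵀ) *ᵥ u) = u ⬝ᵥ ((B i * Y i) *ᵥ u) := by
      rw [← Matrix.transpose_mul, Matrix.mulVec_transpose, Matrix.dotProduct_mulVec,
        dotProduct_comm]
    have h3 : closedLoop A B (fun i => Y i * (X i)⁻¹) i *ᵥ v = A i *ᵥ v + (B i * Y i) *ᵥ u := by
      rw [closedLoop, Matrix.add_mulVec, hu, Matrix.mulVec_mulVec, Matrix.mul_assoc]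
    simp only [blockJ, Matrix.add_mulVec, Matrix.smul_mulVec, dotProduct_add, dotProduct_smul,
      h1, h2, h3, mul_ite, mul_one, mul_zero, Finset.sum_ite_eq, Finset.mem_univ, if_true, hXu,
      ← Matrix.mulVec_mulVec _ (A i) (X i), smul_eq_mul]
    ring
  have hsum : ∑ j, lam κ i j * (((X j)⁻¹ *ᵥ v) ⬝ᵥ v) = lam κ i i * (u ⬝ᵥ v) +
      ∑ j : {j : Fin N // j ≠ i}, lam κ i j * (((X j)⁻¹ *ᵥ v) ⬝ᵥ v) :=
    Fintype.sum_eq_add_sum_subtype_ne _ i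
  rw [hMT, hM, hD, hJ] at hpos
  rw [hsum]
  linarith

end LMI

/-- Finitely many continuous, quadratically homogeneous and negative definite functions are bounded
above by `-ε ‖v‖²` with a common `ε > 0`. -/
theorem exists_forall_le_neg_mul_norm_sq {E k : Type*} [NormedAddCommGroup E] [NormedSpace ℝ E]
    [FiniteDimensional ℝ E] [Finite k] {f : k → E → ℝ} (hf : ∀ a, Continuous (f a))
    (hhom : ∀ a (c : ℝ) v, f a (c • v) = c ^ 2 * f a v) (hneg : ∀ a v, v ≠ 0 → f a v < 0) :
    ∃ ε, 0 < ε ∧ ∀ a v, f a v ≤ -ε * ‖v‖ ^ 2 := by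
  -- On a trivial space the sphere is empty and any `δ` will do.
  have key : ∀ a, ∃ δ, 0 < δ ∧ ∀ v, ‖v‖ = 1 → f a v ≤ -δ := by
    intro a
    rcases (Metric.sphere (0 : E) 1).eq_empty_or_nonempty with h | h
    · exact ⟨1, one_pos, fun v hv => absurd (mem_sphere_zero_iff_norm.2 hv) (h ▸ notMem_empty v)⟩
    · obtain ⟨w, hw, hmax⟩ := (isCompact_sphere (0 : E) 1).exists_isMaxOn h (hf a).continuousOn
      have hw0 : w ≠ 0 := by
        rintro rfl
        simp at hw
      exact ⟨-f a w, by linarith [hneg a w hw0], fun v hv => by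
        rw [neg_neg]; exact hmax (mem_sphere_zero_iff_norm.2 hv)⟩
  choose δ hδ hδf using key
  obtain ⟨ε, hεδ, hε⟩ := ((eventually_all.2 fun a =>
    mem_of_superset (Ioo_mem_nhdsGT (hδ a)) fun y hy => hy.2.le :
      ∀ᶠ ε in 𝓝[>] (0 : ℝ), ∀ a, ε ≤ δ a).and self_mem_nhdsWithin).exists
  refine ⟨ε, hε, fun a v => ?_⟩
  by_cases hv : v = 0
  · have := hhom a 0 0
    simp_all
  · have hn : ‖v‖ ≠ 0 := norm_ne_zero_iff.2 hv
    have h1 := hδf a (‖v‖⁻¹ • v) (by rw [norm_smul, norm_inv, norm_norm, inv_mul_cancel₀ hn])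
    have h2 := hhom a ‖v‖ (‖v‖⁻¹ • v)
    rw [smul_smul, mul_inv_cancel₀ hn, one_smul] at h2
    rw [h2, mul_comm]
    have := hεδ a
    gcongr
    linarith

/-! ### Regular versions of solutions -/

section Regularization

/-- A process with values in a countable discrete space and right-continuous paths is jointly
measurable: it is the eventual value of its samples at the grid times `(⌊k t⌋ + 1) / k`. -/
theorem measurable_uncurry_of_eventually_eq_right {Ω ι : Type*} [MeasurableSpace Ω]
    [MeasurableSpace ι] [DiscreteMeasurableSpace ι] [Countable ι] {y : ℝ → Ω → ι}
    (hm : ∀ t, Measurable (y t)) (hr : ∀ ω t, ∀ᶠ s in 𝓝[>] t, y s ω = y t ω) :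
    Measurable (Function.uncurry y) := by
  set d : ℕ → ℝ → ℝ := fun k t => ((⌊(k : ℝ) * t⌋ : ℤ) + 1 : ℝ) / k with hd
  have hdt : ∀ t, Tendsto (fun k => d k t) atTop (𝓝[>] t) := by
    intro t
    have hlt : ∀ k : ℕ, 0 < k → t < d k t ∧ d k t ≤ t + 1 / k := by
      intro k hk
      have hk' : (0 : ℝ) < k := by exact_mod_cast hk
      constructor
      · rw [hd, lt_div_iff₀ hk', mul_comm]
        exact Int.lt_floor_add_one _
      · rw [hd, div_le_iff₀ hk', add_mul, one_div, inv_mul_cancel₀ hk'.ne', mul_comm t]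
        exact add_le_add_left (Int.floor_le _) 1
    refine tendsto_nhdsWithin_iff.2 ⟨?_, eventually_atTop.2 ⟨1, fun k hk => (hlt k hk).1⟩⟩
    have h1 : Tendsto (fun k : ℕ => t + 1 / (k : ℝ)) atTop (𝓝 t) := by
      simpa using tendsto_const_nhds.add (tendsto_one_div_atTop_nhds_zero_nat (𝕜 := ℝ))
    exact tendsto_of_tendsto_of_tendsto_of_le_of_le' tendsto_const_nhds h1
      (eventually_atTop.2 ⟨1, fun k hk => (hlt k hk).1.le⟩)
      (eventually_atTop.2 ⟨1, fun k hk => (hlt k hk).2⟩)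
  have hmd : ∀ k, Measurable fun p : ℝ × Ω => y (d k p.1) p.2 := by
    intro k
    have h : Measurable fun q : ℤ × Ω => y (((q.1 : ℝ) + 1) / k) q.2 :=
      measurable_from_prod_countable_right fun z => hm (((z : ℝ) + 1) / k)
    exact h.comp ((Int.measurable_floor.comp (measurable_fst.const_mul (k : ℝ))).prodMk
      measurable_snd)
  refine measurable_to_countable' fun i => ?_
  have hset : Function.uncurry y ⁻¹' {i} = ⋃ a : ℕ, ⋂ k ≥ a, {p | y (d k p.1) p.2 = i} := by
    ext ⟨t, ω⟩
    have hev := (hdt t).eventually (hr ω t)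
    simp only [mem_preimage, Function.uncurry_apply_pair, mem_singleton_iff, mem_iUnion, mem_iInter,
      mem_ofPred_eq, ← eventually_atTop]
    constructor
    · rintro rfl
      exact hev
    · intro h
      obtain ⟨k, h1, h2⟩ := (hev.and h).exists
      exact h1 ▸ h2
  rw [hset]
  exact MeasurableSet.iUnion fun a => MeasurableSet.iInter fun k => MeasurableSet.iInter fun _ =>
    hmd k (measurableSet_singleton i)

/-- Functions with equal conditional expectations have equal integrals against bounded functions
measurable for the conditioning σ-algebra. -/
theorem integral_mul_eq_of_condExp_ae_eq {Ω : Type*} {m m₀ : MeasurableSpace Ω} {μ : Measure Ω}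
    [IsFiniteMeasure μ] (hm : m ≤ m₀) {g f₁ f₂ : Ω → ℝ} (hg : StronglyMeasurable[m] g) {c : ℝ}
    (hc : ∀ᵐ ω ∂μ, ‖g ω‖ ≤ c) (h₁ : Integrable f₁ μ) (h₂ : Integrable f₂ μ)
    (h : μ[f₁ | m] =ᵐ[μ] μ[f₂ | m]) : ∫ ω, g ω * f₁ ω ∂μ = ∫ ω, g ω * f₂ ω ∂μ := by
  calc ∫ ω, g ω * f₁ ω ∂μ = ∫ ω, (μ[g * f₁ | m]) ω ∂μ := (integral_condExp hm).symm
    _ = ∫ ω, (μ[g * f₂ | m]) ω ∂μ := by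
        refine integral_congr_ae ?_
        refine (condExp_stronglyMeasurable_mul_of_bound hm hg h₁ c hc).trans
          (EventuallyEq.trans ?_ (condExp_stronglyMeasurable_mul_of_bound hm hg h₂ c hc).symm)
        exact (EventuallyEq.refl _ g).mul h
    _ = ∫ ω, g ω * f₂ ω ∂μ := integral_condExp hm

variable {n N K : ℕ} {Ω : Type*} [MeasurableSpace Ω] {μ : Measure Ω}

theorem measurable_stateRate {C : Fin K → Set (EuclideanSpace ℝ (Fin n))}
    (hC : IsRegionPartition C) (lam : Fin K → Matrix (Fin N) (Fin N) ℝ) (j : Fin N) :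
    Measurable fun p : EuclideanSpace ℝ (Fin n) × Fin N => stateRate lam C p.1 p.2 j :=
  measurable_from_prod_countable_left fun i =>
    Finset.measurable_sum _ fun κ _ =>
      (measurable_const (a := lam κ i j)).indicator (hC.measurableSet κ)

/-- The regions partition the state space, so at each state exactly one rate matrix is in force. -/
theorem exists_stateRate_eq {C : Fin K → Set (EuclideanSpace ℝ (Fin n))}
    (hC : IsRegionPartition C) (lam : Fin K → Matrix (Fin N) (Fin N) ℝ)
    (v : EuclideanSpace ℝ (Fin n)) : ∃ κ, ∀ i j, stateRate lam C v i j = lam κ i j := by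
  obtain ⟨κ, hκ⟩ := mem_iUnion.1 (hC.iUnion_eq ▸ mem_univ v)
  refine ⟨κ, fun i j => ?_⟩
  rw [stateRate, Finset.sum_eq_single κ]
  · simp [hκ]
  · intro κ' _ hne
    exact indicator_of_notMem (disjoint_right.1 (hC.disjoint κ' κ hne) hκ) _
  · simp

theorem exists_abs_stateRate_le {C : Fin K → Set (EuclideanSpace ℝ (Fin n))}
    (hC : IsRegionPartition C) (lam : Fin K → Matrix (Fin N) (Fin N) ℝ) :
    ∃ Λ, ∀ v i j, |stateRate lam C v i j| ≤ Λ := by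
  obtain ⟨Λ, hΛ⟩ := (finite_range fun p : Fin K × Fin N × Fin N =>
    |lam p.1 p.2.1 p.2.2|).bddAbove
  refine ⟨Λ, fun v i j => ?_⟩
  obtain ⟨κ, hκ⟩ := exists_stateRate_eq hC lam v
  rw [hκ]
  exact hΛ ⟨(κ, i, j), rfl⟩

/-- Every solution agrees, outside a null set and for all times simultaneously, with a jump flow:
on a measurable null set containing all irregular paths the state is replaced by `0` and the mode by
a constant. Paths are extended to negative times by their initial value. -/
theorem IsSolution.exists_isJumpFlow [IsProbabilityMeasure μ]
    {A : Fin N → Matrix (Fin n) (Fin n) ℝ}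
    {lam : Fin K → Matrix (Fin N) (Fin N) ℝ} {C : Fin K → Set (EuclideanSpace ℝ (Fin n))}
    (hC : IsRegionPartition C) {x₀ : EuclideanSpace ℝ (Fin n)} {i₀ : Fin N}
    {x : ℝ → Ω → EuclideanSpace ℝ (Fin n)} {θ : ℝ → Ω → Fin N}
    (h : IsSolution μ A lam C x₀ i₀ x θ) :
    ∃ (x' : ℝ → Ω → EuclideanSpace ℝ (Fin n)) (θ' : ℝ → Ω → Fin N),
      IsJumpFlow μ (fun i => Matrix.toEuclideanCLM (𝕜 := ℝ) (A i)) (stateRate lam C) ‖x₀‖ x' θ' ∧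
      ∀ᵐ ω ∂μ, ∀ t, 0 ≤ t → x' t ω = x t ω := by
  classical
  obtain ⟨s, hs, hsm, hsp⟩ := (h.init_state.and (h.mode_right.and
    (h.state_continuous.and h.state_deriv))).exists_measurable_mem
  have hs' : ∀ᵐ ω ∂μ, ω ∈ s := hs
  set x' : ℝ → Ω → EuclideanSpace ℝ (Fin n) := fun t ω => if ω ∈ s then x (max t 0) ω else 0
    with hx'
  set θ' : ℝ → Ω → Fin N := fun t ω => if ω ∈ s then θ (max t 0) ω else i₀ with hθ'
  have hxeq : ∀ t, 0 ≤ t → ∀ ω ∈ s, x' t ω = x t ω := fun t ht ω hω => by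
    simp [hx', hω, max_eq_left ht]
  have hθeq : ∀ t, 0 ≤ t → ∀ ω ∈ s, θ' t ω = θ t ω := fun t ht ω hω => by
    simp [hθ', hω, max_eq_left ht]
  have hmx : Measurable (Function.uncurry x') := by
    refine measurable_uncurry_of_continuous_of_measurable (fun ω => ?_) fun t =>
      Measurable.ite hsm (h.measurable_state _ (le_max_right _ _)) measurable_const
    by_cases hω : ω ∈ s
    · simp only [hx', hω, if_true]
      exact (hsp ω hω).2.2.1.comp_continuous (continuous_id.max continuous_const)
        fun t => mem_Ici.2 (le_max_right _ _)
    · simp only [hx', hω, if_false]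
      exact continuous_const
  have hmθ : Measurable (Function.uncurry θ') := by
    refine measurable_uncurry_of_eventually_eq_right (fun t =>
      Measurable.ite hsm (h.measurable_mode _ (le_max_right _ _)) measurable_const) fun ω t => ?_
    by_cases hω : ω ∈ s
    · simp only [hθ', hω, if_true]
      rcases lt_or_ge t 0 with ht | ht
      · filter_upwards [mem_nhdsWithin_of_mem_nhds (Iio_mem_nhds ht)] with a ha
        rw [max_eq_right (le_of_lt ha), max_eq_right ht.le]
      · filter_upwards [(hsp ω hω).2.1 t ht, self_mem_nhdsWithin] with a ha hta
        rw [max_eq_left ht, max_eq_left (ht.trans (le_of_lt hta)), ha]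
    · simp [hθ', hω]
  refine ⟨x', θ', ?_, hs'.mono fun ω hω t ht => hxeq t ht ω hω⟩
  obtain ⟨Λ, hΛ⟩ := exists_abs_stateRate_le hC lam
  refine ⟨hmx, hmθ, fun ω => ?_, fun ω => ?_, fun ω t ht => ?_, ?_⟩
  · by_cases hω : ω ∈ s
    · rw [hxeq 0 le_rfl ω hω, (hsp ω hω).1]
    · simp [hx', hω]
  · by_cases hω : ω ∈ s
    · exact (hsp ω hω).2.2.1.congr fun t ht => hxeq t ht ω hω
    · simp only [hx', hω, if_false]
      exact continuousOn_const
  · by_cases hω : ω ∈ s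
    · rw [hxeq t ht ω hω, hθeq t ht ω hω]
      exact ((hsp ω hω).2.2.2 t ht).congr (fun a ha => hxeq a (ht.trans ha) ω hω)
        (hxeq t ht ω hω)
    · simp only [hx', hω, if_false, map_zero]
      exact hasDerivWithinAt_const t (Ici t) 0
  · rintro t a ht ha j g hg ⟨c, hc⟩
    have hta : 0 ≤ t + a := add_nonneg ht ha
    have hmr : Measurable (Function.uncurry fun b ω => stateRate lam C (x' b ω) (θ' b ω) j) :=
      (measurable_stateRate hC lam j).comp (hmx.prodMk hmθ)
    have hmind : Measurable fun i : Fin N => if i = j then (1 : ℝ) else 0 := Measurable.of_discrete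
    have hpm : Measurable fun ω => (x t ω, θ t ω) :=
      (h.measurable_state t ht).prodMk (h.measurable_mode t ht)
    have hI : ∀ b, 0 ≤ b → Integrable (fun ω => if θ b ω = j then (1 : ℝ) else 0) μ := fun b hb =>
      Integrable.of_bound (hmind.comp (h.measurable_mode b hb)).aestronglyMeasurable 1
        (Eventually.of_forall fun ω => by split_ifs <;> simp)
    have hinteq : ∀ ω ∈ s, ∫ b in t..(t + a), stateRate lam C (x' b ω) (θ' b ω) j =
        ∫ b in t..(t + a), stateRate lam C (x b ω) (θ b ω) j := by
      intro ω hω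
      refine intervalIntegral.integral_congr fun b hb => ?_
      rw [uIcc_of_le (by linarith)] at hb
      simp only [hxeq b (ht.trans hb.1) ω hω, hθeq b (ht.trans hb.1) ω hω]
    have hIint : Integrable (fun ω => ∫ b in t..(t + a), stateRate lam C (x b ω) (θ b ω) j) μ :=
      (integrable_intervalIntegral hmr (by linarith) fun ω b _ => hΛ _ _ _).congr
        (hs'.mono hinteq)
    have key := integral_mul_eq_of_condExp_ae_eq hpm.comap_le
      (g := fun ω => g (x t ω, θ t ω))
      (hg.comp (comap_measurable fun ω => (x t ω, θ t ω))).stronglyMeasurable (c := c)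
      (hs'.mono fun ω hω => by
        have := hc ω
        rwa [hxeq t ht ω hω, hθeq t ht ω hω] at this)
      (hI (t + a) hta) ((hI t ht).add hIint) (h.mode_rate t a ht ha j)
    refine (integral_congr_ae (hs'.mono fun ω hω => ?_)).trans
      (key.trans (integral_congr_ae (hs'.mono fun ω hω => ?_)))
    · simp only [hxeq t ht ω hω, hθeq t ht ω hω, hθeq _ hta ω hω]
    · simp only [hxeq t ht ω hω, hθeq t ht ω hω, hinteq ω hω, Pi.add_apply]

end Regularization

end SDJLS

theorem theorem2 {n m N K : ℕ} {Ω : Type*} [MeasurableSpace Ω]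
    (μ : MeasureTheory.Measure Ω) [MeasureTheory.IsProbabilityMeasure μ]
    (A : Fin N → Matrix (Fin n) (Fin n) ℝ) (B : Fin N → Matrix (Fin n) (Fin m) ℝ)
    (lam : Fin K → Matrix (Fin N) (Fin N) ℝ) (hlam : SDJLS.IsRateFamily lam)
    (C : Fin K → Set (EuclideanSpace ℝ (Fin n))) (hC : SDJLS.IsRegionPartition C)
    (X : Fin N → Matrix (Fin n) (Fin n) ℝ) (Y : Fin N → Matrix (Fin m) (Fin n) ℝ)
    (hX : ∀ i, (X i).PosDef)
    (hLMI : ∀ (κ : Fin K) (i : Fin N),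
      (-(Matrix.fromBlocks (SDJLS.blockJ A B lam X Y κ i) (SDJLS.blockM lam X κ i)
        (SDJLS.blockM lam X κ i)ᵀ (-(SDJLS.blockX X i)))).PosDef) :
    SDJLS.StochasticallyStable μ (SDJLS.closedLoop A B fun i => Y i * (X i)⁻¹) lam C := by
  intro x₀ i₀ x θ h
  set T : Fin N → EuclideanSpace ℝ (Fin n) →L[ℝ] EuclideanSpace ℝ (Fin n) := fun i =>
    Matrix.toEuclideanCLM (𝕜 := ℝ) (SDJLS.closedLoop A B (fun i => Y i * (X i)⁻¹) i) with hT
  set S : Fin N → EuclideanSpace ℝ (Fin n) →L[ℝ] EuclideanSpace ℝ (Fin n) := fun i =>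
    Matrix.toEuclideanCLM (𝕜 := ℝ) (X i)⁻¹ with hSdef
  have hinner : ∀ v w : EuclideanSpace ℝ (Fin n), inner ℝ v w = v.ofLp ⬝ᵥ w.ofLp := fun v w => by
    rw [EuclideanSpace.inner_eq_star_dotProduct, star_trivial, dotProduct_comm]
  have hS : ∀ i v w, inner ℝ (S i v) w = inner ℝ v (S i w) := by
    intro i v w
    have hsymm : ((X i)⁻¹)ᵀ = (X i)⁻¹ := by simpa using (hX i).inv.isHermitian.eq
    rw [hinner, hinner]
    simp only [hSdef, Matrix.ofLp_toEuclideanCLM]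
    rw [Matrix.dotProduct_mulVec, ← Matrix.mulVec_transpose, hsymm]
  have hS0 : ∀ i v, 0 ≤ inner ℝ (S i v) v := by
    intro i v
    rw [hS, hinner]
    simpa [hSdef] using (hX i).inv.posSemidef.dotProduct_mulVec_nonneg v.ofLp
  obtain ⟨ε, hε, hεle⟩ := SDJLS.exists_forall_le_neg_mul_norm_sq
    (f := fun (a : Fin K × Fin N) (v : EuclideanSpace ℝ (Fin n)) =>
      2 * inner ℝ (S a.2 v) (T a.2 v) + ∑ j, lam a.1 a.2 j * inner ℝ (S j v) v)
    (fun a => by fun_prop)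
    (fun a c v => by
      simp only [map_smul, inner_smul_left, inner_smul_right, Finset.mul_sum, mul_add,
        RCLike.conj_to_real]
      congr 1
      · ring
      · exact Finset.sum_congr rfl fun j _ => by ring)
    (fun a v hv => by
      have := SDJLS.lyapunov_neg_of_lmi A B hlam Y hX (hLMI a.1 a.2) (v := v.ofLp)
        (by simpa using hv)
      simpa only [hinner, hSdef, hT, Matrix.ofLp_toEuclideanCLM] using this)
  obtain ⟨x', θ', hflow, hae⟩ := h.exists_isJumpFlow hC
  obtain ⟨Λ, hΛ⟩ := SDJLS.exists_abs_stateRate_le hC lam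
  refine lt_of_eq_of_lt (lintegral_congr_ae (hae.mono fun ω hω => ?_))
    (hflow.lintegral_norm_sq_lt_top hS hS0 hε (SDJLS.measurable_stateRate hC lam) hΛ fun i v => ?_)
  · exact setLIntegral_congr_fun measurableSet_Ioi fun t ht => by
      simp only [hω t (le_of_lt ht)]
  · obtain ⟨κ, hκ⟩ := SDJLS.exists_stateRate_eq hC lam v
    simp only [hκ]
    exact hεle (κ, i) v
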